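/- All trees below are finite, rooted, ordered binary trees: the root has degree $1$ (so there is a root edge), and every vertex that is neither the root nor a leaf has degree $3$, with a left and a right child. Write $A\,B$ for the tree with left subtree $A$ and right subtree $B$. The vertices of the $1$-skeleton of the $d$-dimensional associahedron $A_d$ are the trees with $d+2$ leaves; two such trees are joined by an edge if one is obtained from the other by a single rotation, that is, by replacing the subtree $(A\,B)\,C$ below some vertex by $A\,(B\,C)$ and keeping the rest of the tree. A color vector of length $n$ is a tuple $\mathbf c=(c_1,\dots,c_n)$ of elements of $\mathbf Z_2\times\mathbf Z_2$. For a tree $T$ with $n$ leaves it determines a unique coloring of the edges of $T$ (including the root edge) by elements of $\mathbf Z_2\times\mathbf Z_2$ in which the edge at the $i$-th leaf from the left has color $c_i$ and the colors of the three edges at each vertex of degree $3$ sum to $0$. The vector $\mathbf c$ is valid for $T$ if this coloring is a proper edge $3$-coloring, i.e. it uses only the three nonzero colors and the three edges at each vertex of degree $3$ have different colors. The vector $\mathbf c$ is acceptable if it is valid for at least one tree with $n$ leaves. For $n=d+2$, the color graph of $\mathbf c$ is the subgraph of the $1$-skeleton of $A_d$ induced on the trees for which $\mathbf c$ is valid.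 **Theorem.** Let $d\ge 0$ and let $\mathbf c$ be an acceptable color vector of length $d+2$. Then the color graph of $\mathbf c$ in $A_d$ is either connected or has no edges. -/

import Mathlib

namespace ColoredTree

/-- Finite, rooted, locally ordered binary trees. `BinaryTree.nil` is the trivial tree (a root `*`
of degree one joined by the root edge to a single leaf), and `node () L R` is the tree with left
subtree `L` and right subtree `R`. -/
abbrev Tree := BinaryTree Unit

/-- The group of colors. -/
abbrev Color := ZMod 2 × ZMod 2

/-- Addresses of the vertices other than the root `*`: words in `0` (`false`, go to the left child)
and `1` (`true`, go to the right child). Every edge is named by the address of its lower end,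
so the root edge is named by the empty word. -/
abbrev Address := List Bool

/-- The addresses of the leaves, in left-right order. -/
def leaves : Tree → List Address
  | .nil => [[]]
  | .node _ L R => (leaves L).map (List.cons false) ++ (leaves R).map (List.cons true)

/-- The addresses of the internal vertices (those of degree three). -/
def internals : Tree → List Address
  | .nil => []
  | .node _ L R =>
      [] :: ((internals L).map (List.cons false) ++ (internals R).map (List.cons true))

/-- The edges of `T` (root edge, internal edges and leaf edges), each named by its lower end. -/
def edges (T : Tree) : Set Address := {u | u ∈ leaves T ∨ u ∈ internals T}

/-- `κ` is a coloring of the edges of `T` that gives the leaf edges the colors listed in `c`, from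
left to right, and for which the colors of the three edges at each vertex of degree three sum to
zero. Only the values of `κ` on `edges T` matter; the equation forces `T` to have as many leaves as
`c` has entries. -/
structure IsDetermined {n : ℕ} (T : Tree) (c : Fin n → Color) (κ : Address → Color) : Prop where
  leaf : (leaves T).map κ = List.ofFn c
  sum_eq_zero : ∀ u ∈ internals T, κ u + κ (u ++ [false]) + κ (u ++ [true]) = 0

theorem exists_coloring (T : Tree) : ∀ l : List Color, l.length = T.numLeaves →
    ∃ κ : Address → Color, (leaves T).map κ = l ∧
      ∀ u ∈ internals T, κ u + κ (u ++ [false]) + κ (u ++ [true]) = 0 := by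
  induction T with
  | nil =>
    intro l hl
    obtain ⟨a, rfl⟩ := List.length_eq_one_iff.1 hl
    exact ⟨fun _ => a, by simp [leaves], by simp [internals]⟩
  | node a L R hL hR =>
    intro l hl
    simp only [BinaryTree.numLeaves] at hl
    obtain ⟨κ₀, h₀, s₀⟩ := hL (l.take L.numLeaves) (by simp; omega)
    obtain ⟨κ₁, h₁, s₁⟩ := hR (l.drop L.numLeaves) (by simp; omega)
    let κ : Address → Color := fun u => match u with
      | [] => -(κ₀ [] + κ₁ [])
      | false :: v => κ₀ v
      | true :: v => κ₁ v
    refine ⟨κ, ?_, ?_⟩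
    · have e₀ : κ ∘ List.cons false = κ₀ := rfl
      have e₁ : κ ∘ List.cons true = κ₁ := rfl
      simp [leaves, e₀, e₁, h₀, h₁]
    · intro u hu
      simp only [internals, List.mem_cons, List.mem_append, List.mem_map] at hu
      rcases hu with rfl | ⟨v, hv, rfl⟩ | ⟨v, hv, rfl⟩
      · show -(κ₀ [] + κ₁ []) + κ₀ [] + κ₁ [] = 0
        abel
      · exact s₀ v hv
      · exact s₁ v hv

theorem coloring_unique (T : Tree) : ∀ κ κ' : Address → Color,
    (leaves T).map κ = (leaves T).map κ' →
    (∀ u ∈ internals T, κ u + κ (u ++ [false]) + κ (u ++ [true]) = 0) →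
    (∀ u ∈ internals T, κ' u + κ' (u ++ [false]) + κ' (u ++ [true]) = 0) →
    κ [] = κ' [] ∧ Set.EqOn κ κ' (edges T) := by
  induction T with
  | nil =>
    intro κ κ' h _ _
    have h' : κ [] = κ' [] := by simpa [leaves] using h
    exact ⟨h', fun u hu => by simp_all [edges, leaves, internals]⟩
  | node a L R hL hR =>
    intro κ κ' h s s'
    simp only [leaves, List.map_append, List.map_map] at h
    obtain ⟨h₀, h₁⟩ := List.append_inj h (by simp)
    obtain ⟨r₀, q₀⟩ := hL (κ ∘ List.cons false) (κ' ∘ List.cons false) h₀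
      (fun u hu => s _ (by simp [internals, hu])) (fun u hu => s' _ (by simp [internals, hu]))
    obtain ⟨r₁, q₁⟩ := hR (κ ∘ List.cons true) (κ' ∘ List.cons true) h₁
      (fun u hu => s _ (by simp [internals, hu])) (fun u hu => s' _ (by simp [internals, hu]))
    have t := s [] (by simp [internals])
    have t' := s' [] (by simp [internals])
    simp only [List.nil_append] at t t'
    simp only [Function.comp_apply] at r₀ r₁
    have r : κ [] = κ' [] := by
      rw [r₀, r₁, ← t'] at t
      exact add_right_cancel (add_right_cancel t)
    refine ⟨r, fun u hu => ?_⟩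
    simp only [edges, leaves, internals, Set.mem_ofPred_eq, List.mem_cons, List.mem_append,
      List.mem_map] at hu
    rcases hu with (⟨v, hv, rfl⟩ | ⟨v, hv, rfl⟩) | rfl | ⟨v, hv, rfl⟩ | ⟨v, hv, rfl⟩
    · exact q₀ (Or.inl hv)
    · exact q₁ (Or.inl hv)
    · exact r
    · exact q₀ (Or.inr hv)
    · exact q₁ (Or.inr hv)

/-- A color vector determines an edge coloring of every tree with the right number of leaves, and
that coloring is unique on the edges of the tree. -/
theorem exists_unique_isDetermined {n : ℕ} (T : Tree) (hT : T.numLeaves = n) (c : Fin n → Color) :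
    ∃ κ : Address → Color, IsDetermined T c κ ∧
      ∀ κ' : Address → Color, IsDetermined T c κ' → Set.EqOn κ κ' (edges T) := by
  obtain ⟨κ, h, s⟩ := exists_coloring T (List.ofFn c) (by simp [hT])
  exact ⟨κ, ⟨h, s⟩, fun κ' h' =>
    (coloring_unique T κ κ' (h.trans h'.leaf.symm) s h'.sum_eq_zero).2⟩

/-- `κ` is a proper edge 3-coloring of `T`: it uses only the three nonzero colors, and the three
edges at each vertex of degree three have different colors. -/
structure IsProper (T : Tree) (κ : Address → Color) : Prop where
  ne_zero : ∀ e ∈ edges T, κ e ≠ 0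
  distinct : ∀ u ∈ internals T,
    κ u ≠ κ (u ++ [false]) ∧ κ u ≠ κ (u ++ [true]) ∧ κ (u ++ [false]) ≠ κ (u ++ [true])

/-- The color vector `c` is valid for `T`: the edge coloring it determines (which is unique on the
edges of `T`) is a proper edge 3-coloring. -/
def Valid {n : ℕ} (T : Tree) (c : Fin n → Color) : Prop :=
  ∃ κ : Address → Color, IsDetermined T c κ ∧ IsProper T κ

/-- A color vector is acceptable if it is valid for some finite binary tree. -/
def Acceptable {n : ℕ} (c : Fin n → Color) : Prop := ∃ T : Tree, Valid T c

/-- `Rotates T S`: `S` arises from `T` by a rotation at some vertex `u`, that is, the subtree at `u`,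
of the form `(A B) C`, is replaced by `A (B C)`, and the rest of the tree is kept. -/
inductive Rotates : Tree → Tree → Prop
  | pivot (A B C : Tree) :
      Rotates (.node () (.node () A B) C) (.node () A (.node () B C))
  | left {L L' : Tree} (R : Tree) (h : Rotates L L') : Rotates (.node () L R) (.node () L' R)
  | right (L : Tree) {R R' : Tree} (h : Rotates R R') : Rotates (.node () L R) (.node () L R')

/-- The 1-skeleton of the associahedron `A_d`: its vertices are the binary trees with `d + 2`
leaves, and its edges join two trees that differ by one rotation. -/
def associahedron (d : ℕ) : SimpleGraph {T : Tree // T.numLeaves = d + 2} :=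
  SimpleGraph.fromRel fun T S => Rotates T.1 S.1

/-- The color graph of `c`: the subgraph of the 1-skeleton of `A_d` spanned by the trees for which
`c` is valid. -/
def colorGraph {d : ℕ} (c : Fin (d + 2) → Color) :
    SimpleGraph {T : {T : Tree // T.numLeaves = d + 2} | Valid T.1 c} :=
  (associahedron d).induce {T | Valid T.1 c}

end ColoredTree

/-!
Read a tree as a triangulation of a polygon: its leaf edges and its root edge are the sides, its
internal edges are the diagonals. If the vertices of the polygon are colored by the partial sums of
the color vector, the color of an edge is the sum of the colors of its ends. So the vector is valid
for a tree exactly when its triangulation has no edge with two ends of the same color.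

A rotation exchanges the diagonals of a quadrilateral, whose vertices then have four different
colors: if at most three colors occur, there are no edges. If four colors occur, any two properly
colored triangulations are connected by flips, by induction on the number of vertices. Two
triangulations with a common ear are connected after deleting it, as long as the other vertices
still have four colors, and flips lead from every triangulation to one with such an ear. Two
non-adjacent ears occur together in some triangulation. Adjacent ears `b`, `c` between `a` and `d`
are exchanged by a single flip if `a` and `d` have different colors, and otherwise by two flips
inside a fan at a vertex whose color differs from those of `a`, `b`, `c`.
-/

namespace ColoredTree

/-! ### Grafting -/

theorem Rotates.numLeaves_eq {T S : Tree} (h : Rotates T S) : T.numLeaves = S.numLeaves := by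
  induction h with
  | pivot => simp [BinaryTree.numLeaves, add_assoc]
  | left R _ ih => simp [BinaryTree.numLeaves, ih]
  | right L _ ih => simp [BinaryTree.numLeaves, ih]

/-- The scion `U` grafted onto the stock `T`: the leaf of `T` with index `i`, counted from `0` on
the left, is replaced by `U`. An index past the last leaf stands for the last leaf. -/
def graft (U : Tree) : Tree → ℕ → Tree
  | .nil, _ => U
  | .node a L R, i =>
    if i < L.numLeaves then .node a (graft U L i) R
    else .node a L (graft U R (i - L.numLeaves))

/-- The tree with two leaves; grafting it onto a leaf glues an ear to a side of the polygon. -/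
def cherry : Tree := .node () .nil .nil

theorem graft_node_left {U L R : Tree} {a : Unit} {i : ℕ} (h : i < L.numLeaves) :
    graft U (.node a L R) i = .node a (graft U L i) R := by
  simp [graft, h]

theorem graft_node_right {U L R : Tree} {a : Unit} {i : ℕ} :
    graft U (.node a L R) (L.numLeaves + i) = .node a L (graft U R i) := by
  simp [graft]

theorem numLeaves_graft {U T : Tree} {i : ℕ} (h : i < T.numLeaves) :
    (graft U T i).numLeaves + 1 = T.numLeaves + U.numLeaves := by
  induction T generalizing i with
  | nil => simp [graft, BinaryTree.numLeaves, add_comm]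
  | node a L R hL hR =>
    simp only [BinaryTree.numLeaves] at h
    rw [graft]
    split_ifs with hi
    · have := hL hi
      simp only [BinaryTree.numLeaves]; omega
    · have := hR (i := i - L.numLeaves) (by omega)
      simp only [BinaryTree.numLeaves]; omega

theorem graft_graft_inside {U V T : Tree} {i k : ℕ} (hi : i < T.numLeaves)
    (hk : k < U.numLeaves) : graft V (graft U T i) (i + k) = graft (graft V U k) T i := by
  induction T generalizing i with
  | nil =>
    have : i = 0 := by simpa [BinaryTree.numLeaves] using hi
    simp [graft, this]
  | node a L R hL hR =>
    simp only [BinaryTree.numLeaves] at hi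
    by_cases h : i < L.numLeaves
    · have := numLeaves_graft (U := U) h
      rw [graft_node_left h, graft_node_left h, graft_node_left (by omega), hL h]
    · obtain ⟨j, rfl⟩ := Nat.exists_eq_add_of_le (not_lt.1 h)
      rw [graft_node_right, graft_node_right, add_assoc, graft_node_right, hR (by omega)]

theorem graft_graft_comm {U V T : Tree} {i k : ℕ} (hi : i < k) (hk : k < T.numLeaves) :
    graft V (graft U T k) i = graft U (graft V T i) (k + V.numLeaves - 1) := by
  have hV := BinaryTree.numLeaves_pos V
  induction T generalizing i k with
  | nil =>
    simp only [BinaryTree.numLeaves] at hk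
    omega
  | node a L R hL hR =>
    simp only [BinaryTree.numLeaves] at hk
    by_cases h : k < L.numLeaves
    · have := numLeaves_graft (U := U) h
      have hU := BinaryTree.numLeaves_pos U
      have := numLeaves_graft (U := V) (hi.trans h)
      rw [graft_node_left h, graft_node_left (by omega), graft_node_left (by omega),
        graft_node_left (by omega), hL hi h]
    · obtain ⟨j, rfl⟩ := Nat.exists_eq_add_of_le (not_lt.1 h)
      by_cases h' : i < L.numLeaves
      · have := numLeaves_graft (U := V) h'
        rw [graft_node_right, graft_node_left h', graft_node_left h',
          show L.numLeaves + j + V.numLeaves - 1 = (graft V L i).numLeaves + j by omega,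
          graft_node_right]
      · obtain ⟨m, rfl⟩ := Nat.exists_eq_add_of_le (not_lt.1 h')
        rw [graft_node_right, graft_node_right, graft_node_right,
          show L.numLeaves + j + V.numLeaves - 1 = L.numLeaves + (j + V.numLeaves - 1) by omega,
          graft_node_right, hR (by omega) (by omega)]

theorem Rotates.graft_stock {T S : Tree} (h : Rotates T S) (U : Tree) (i : ℕ) :
    Rotates (graft U T i) (graft U S i) := by
  induction h generalizing i with
  | pivot A B C =>
    by_cases h₁ : i < A.numLeaves
    · rw [graft_node_left (by simp only [BinaryTree.numLeaves]; omega), graft_node_left h₁,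
        graft_node_left h₁]
      exact .pivot _ _ _
    · obtain ⟨j, rfl⟩ := Nat.exists_eq_add_of_le (not_lt.1 h₁)
      rw [graft_node_right]
      by_cases h₂ : j < B.numLeaves
      · rw [graft_node_left (by simp only [BinaryTree.numLeaves]; omega), graft_node_right,
          graft_node_left h₂]
        exact .pivot _ _ _
      · obtain ⟨k, rfl⟩ := Nat.exists_eq_add_of_le (not_lt.1 h₂)
        rw [graft_node_right, ← add_assoc]
        exact (graft_node_right (L := .node () A B)) ▸ .pivot _ _ _
  | @left L L' R h ih =>
    have := h.numLeaves_eq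
    by_cases h₁ : i < L.numLeaves
    · rw [graft_node_left h₁, graft_node_left (this ▸ h₁)]
      exact .left _ (ih _)
    · obtain ⟨j, rfl⟩ := Nat.exists_eq_add_of_le (not_lt.1 h₁)
      rw [graft_node_right, this, graft_node_right]
      exact .left _ h
  | @right L R R' h ih =>
    by_cases h₁ : i < L.numLeaves
    · rw [graft_node_left h₁, graft_node_left h₁]
      exact .right _ h
    · obtain ⟨j, rfl⟩ := Nat.exists_eq_add_of_le (not_lt.1 h₁)
      rw [graft_node_right, graft_node_right]
      exact .right _ (ih _)

theorem Rotates.graft_scion {U V : Tree} (h : Rotates U V) (T : Tree) (i : ℕ) :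
    Rotates (graft U T i) (graft V T i) := by
  induction T generalizing i with
  | nil => exact h
  | node a L R hL hR =>
    rw [graft, graft]
    split_ifs
    · exact .left _ (hL _)
    · exact .right _ (hR _)

/-! ### Properly colored triangulations of a polygon -/

section Polygon

variable {α : Type*}

theorem append_cons_eq_append_cons {p q r s : List α} {a x : α} (h : p ++ a :: q = r ++ x :: s) :
    (p = r ∧ a = x ∧ q = s) ∨ (∃ m, r = p ++ a :: m ∧ q = m ++ x :: s) ∨
      ∃ m, p = r ++ x :: m ∧ s = m ++ a :: q := by
  obtain ⟨_ | ⟨_, m⟩, rfl, h⟩ | ⟨_ | ⟨_, m⟩, rfl, h⟩ := List.append_eq_append_iff.1 h <;> grind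

/-- The cyclic sequence `w` has no two equal neighbours. -/
def IsPolygon (w : List α) : Prop := w.IsChain (· ≠ ·) ∧ w.head? ≠ w.getLast?

theorem IsPolygon.ne {p q : List α} {a b : α} (h : IsPolygon (p ++ a :: b :: q)) : a ≠ b :=
  (List.isChain_append_cons_cons.1 h.1).2.1

theorem IsPolygon.ne_and_ne {p q : List α} {a b c : α} (h : IsPolygon (p ++ a :: b :: c :: q)) :
    a ≠ b ∧ b ≠ c := by
  have h := (List.isChain_append_cons_cons.1 h.1).2
  exact ⟨h.1, (List.isChain_cons_cons.1 h.2).1⟩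

/-- The tree `T`, read as a triangulation of a polygon whose vertices carry the colors `w`, listed
from one end of the root edge to the other, has no edge with two ends of the same color. Leaves are
the sides of the polygon other than the root edge; `node () L R` has a triangle on the root edge
whose third vertex `b` separates the polygon of `L` from that of `R`. -/
def Triangulates : Tree → List α → Prop
  | .nil, w => ∃ a b, a ≠ b ∧ w = [a, b]
  | .node _ L R, w => ∃ p b q, w = p ++ b :: q ∧
      Triangulates L (p ++ [b]) ∧ Triangulates R (b :: q) ∧ w.head? ≠ w.getLast?

theorem Triangulates.length_eq {T : Tree} {w : List α} (h : Triangulates T w) :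
    w.length = T.numLeaves + 1 := by
  induction T generalizing w with
  | nil => obtain ⟨a, b, -, rfl⟩ := h; rfl
  | node _ L R hL hR =>
    obtain ⟨p, b, q, rfl, h₁, h₂, -⟩ := h
    have := hL h₁
    have := hR h₂
    simp only [BinaryTree.numLeaves, List.length_append, List.length_cons, List.length_nil] at *
    omega

theorem Triangulates.isPolygon {T : Tree} {w : List α} (h : Triangulates T w) : IsPolygon w := by
  induction T generalizing w with
  | nil => obtain ⟨a, b, hab, rfl⟩ := h; simp [IsPolygon, hab]
  | node _ L R hL hR =>
    obtain ⟨p, b, q, rfl, h₁, h₂, h⟩ := h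
    exact ⟨List.isChain_split.2 ⟨(hL h₁).1, (hR h₂).1⟩, h⟩

theorem Triangulates.ends_ne {T : Tree} {u : List α} {x y : α}
    (h : Triangulates T (x :: (u ++ [y]))) : x ≠ y := by
  simpa [List.getLast?_cons] using h.isPolygon.2

theorem triangulates_nil {x y : α} (h : x ≠ y) : Triangulates .nil [x, y] := ⟨x, y, h, rfl⟩

theorem triangulates_node {L R : Tree} {u v : List α} {x b y : α}
    (hL : Triangulates L (x :: (u ++ [b]))) (hR : Triangulates R (b :: (v ++ [y]))) (hxy : x ≠ y) :
    Triangulates (.node () L R) (x :: (u ++ b :: (v ++ [y]))) :=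
  ⟨x :: u, b, v ++ [y], rfl, hL, hR, by simpa [List.getLast?_cons]⟩

theorem Triangulates.node_nil {L : Tree} {u : List α} {x b y : α}
    (hL : Triangulates L (x :: (u ++ [b]))) (hby : b ≠ y) (hxy : x ≠ y) :
    Triangulates (.node () L .nil) (x :: ((u ++ [b]) ++ [y])) := by
  simpa using triangulates_node (v := []) hL (triangulates_nil hby) hxy

theorem Triangulates.nil_node {R : Tree} {v : List α} {x b y : α}
    (hR : Triangulates R (b :: (v ++ [y]))) (hxb : x ≠ b) (hxy : x ≠ y) :
    Triangulates (.node () .nil R) (x :: ((b :: v) ++ [y])) :=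
  triangulates_node (u := []) (triangulates_nil hxb) hR hxy

theorem Triangulates.exists_of_node {L R : Tree} {w : List α}
    (h : Triangulates (.node () L R) w) : ∃ x u b v y, w = x :: (u ++ b :: (v ++ [y])) ∧
      Triangulates L (x :: (u ++ [b])) ∧ Triangulates R (b :: (v ++ [y])) ∧ x ≠ y := by
  obtain ⟨p, b, q, rfl, hL, hR, h⟩ := h
  have hp := hL.length_eq
  have hq := hR.length_eq
  cases p with
  | nil => grind [L.numLeaves_pos]
  | cons x u =>
    cases q using List.reverseRecOn with
    | nil => grind [R.numLeaves_pos]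
    | append_singleton v y =>
      exact ⟨x, u, b, v, y, rfl, hL, hR, by simpa [List.getLast?_cons] using h⟩

theorem Triangulates.eq_nil {T : Tree} {w : List α} (h : Triangulates T w) (hw : w.length = 2) :
    T = .nil := by
  cases T with
  | nil => rfl
  | node _ L R => grind [h.length_eq, L.numLeaves_pos, R.numLeaves_pos, BinaryTree.numLeaves]

theorem triangulates_graft {T U : Tree} {p q u : List α} {a b : α}
    (hT : Triangulates T (p ++ a :: b :: q)) (hU : Triangulates U (a :: (u ++ [b]))) :
    Triangulates (graft U T p.length) (p ++ a :: (u ++ b :: q)) := by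
  induction T generalizing p q with
  | nil =>
    have := hT.length_eq
    simp only [BinaryTree.numLeaves, List.length_append, List.length_cons] at this
    obtain rfl := List.eq_nil_of_length_eq_zero (l := p) (by omega)
    obtain rfl := List.eq_nil_of_length_eq_zero (l := q) (by omega)
    exact hU
  | node _ L R hL hR =>
    obtain ⟨s, x, t, hw, h₁, h₂, hne⟩ := hT
    have hs : s.length = L.numLeaves := by simpa using h₁.length_eq
    replace hne : (p ++ a :: (u ++ b :: q)).head? ≠ (p ++ a :: (u ++ b :: q)).getLast? := by
      simpa [← hw, List.head?_append, List.getLast?_append, List.getLast?_cons] using hne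
    obtain ⟨r, rfl, hr⟩ | ⟨r, rfl, hr⟩ : (∃ r, s = p ++ a :: r ∧ b :: q = r ++ x :: t) ∨
        ∃ r, p = s ++ r ∧ x :: t = r ++ a :: b :: q := by
      obtain ⟨rfl, rfl, rfl⟩ | h | ⟨r, rfl, rfl⟩ := append_cons_eq_append_cons hw
      · exact .inr ⟨[], by simp⟩
      · exact .inl h
      · exact .inr ⟨x :: r, rfl, rfl⟩
    · obtain ⟨r', hr'⟩ : ∃ r', r ++ [x] = b :: r' := by cases r <;> simp_all
      have hL' := hL (p := p) (q := r') (by simpa [← hr'] using h₁)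
      rw [graft_node_left (by simp [← hs])]
      exact ⟨p ++ a :: (u ++ r), x, t, by simp [hr], by simpa [← hr'] using hL', h₂, hne⟩
    · have hR' := hR (hr ▸ h₂)
      obtain ⟨t', ht'⟩ : ∃ t', r ++ a :: (u ++ b :: q) = x :: t' := by cases r <;> simp_all
      rw [List.length_append, hs, graft_node_right]
      exact ⟨s, x, t', by simp [← ht'], h₁, ht' ▸ hR', hne⟩

theorem triangulates_cherry {a b c : α} (hab : a ≠ b) (hbc : b ≠ c) (hac : a ≠ c) :
    Triangulates cherry [a, b, c] :=
  triangulates_node (u := []) (v := []) (triangulates_nil hab) (triangulates_nil hbc) hac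

/-- The trees for which the vertex `b` of the polygon `p ++ a :: b :: c :: q` is an ear, that is,
`b` lies on a single triangle, which has the neighbours `a` and `c` of `b` as its other vertices.
Only the remaining polygon `p ++ a :: c :: q` enters, not the color of `b`. -/
def earTrees (p : List α) (a c : α) (q : List α) : Set Tree :=
  (graft cherry · p.length) '' {T | Triangulates T (p ++ a :: c :: q)}

theorem ne_of_mem_earTrees {p q : List α} {a c : α} {T : Tree} (hT : T ∈ earTrees p a c q) :
    a ≠ c := by
  obtain ⟨T, hT, -⟩ := hT
  exact IsPolygon.ne (Triangulates.isPolygon hT)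

theorem Triangulates.of_mem_earTrees {p q : List α} {a b c : α} {T : Tree}
    (hT : T ∈ earTrees p a c q) (hab : a ≠ b) (hbc : b ≠ c) :
    Triangulates T (p ++ a :: b :: c :: q) := by
  have hac := ne_of_mem_earTrees hT
  obtain ⟨T, hT, rfl⟩ := hT
  exact triangulates_graft (u := [b]) hT (triangulates_cherry hab hbc hac)

theorem graft_mem_earTrees {T U : Tree} {p q r s : List α} {a c x y : α}
    (hT : Triangulates T (r ++ x :: y :: s)) (hU : U ∈ earTrees p a c q)
    (hx : (p ++ [a]).head? = some x) (hy : (c :: q).getLast? = some y) :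
    graft U T r.length ∈ earTrees (r ++ p) a c (q ++ s) := by
  obtain ⟨U, hU : Triangulates U (p ++ a :: c :: q), rfl⟩ := hU
  obtain ⟨p', hp'⟩ := List.head?_eq_some_iff.1 hx
  obtain ⟨q', hq'⟩ := List.getLast?_eq_some_iff.1 hy
  have hw : p ++ a :: c :: q = x :: ((p' ++ q') ++ [y]) := by
    simpa [hq'] using congrArg (· ++ c :: q) hp'
  have hr : r.length < T.numLeaves := by grind [hT.length_eq]
  have hp : p.length < U.numLeaves := by grind [hU.length_eq]
  refine ⟨graft U T r.length, ?_, ?_⟩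
  · have h := triangulates_graft hT (hw ▸ hU)
    rwa [show r ++ x :: (p' ++ q' ++ y :: s) = (r ++ p) ++ a :: c :: (q ++ s) by
      simpa using congrArg (r ++ · ++ s) hw.symm] at h
  · rw [List.length_append]
    exact graft_graft_inside hr hp

theorem Triangulates.exists_mem_earTrees {T : Tree} {w : List α} (hT : Triangulates T w)
    (hw : 3 ≤ w.length) :
    ∃ p a b c q, w = p ++ a :: b :: c :: q ∧ T ∈ earTrees p a c q := by
  induction T generalizing w with
  | nil => obtain ⟨a, b, -, rfl⟩ := hT; simp at hw
  | node _ L R hL hR =>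
    obtain ⟨x, u, z, v, y, rfl, h₁, h₂, hxy⟩ := hT.exists_of_node
    by_cases hu : u = []
    · by_cases hv : v = []
      · subst hu hv
        obtain rfl := h₁.eq_nil rfl
        obtain rfl := h₂.eq_nil rfl
        exact ⟨[], x, z, y, [], rfl, .nil, ⟨x, y, hxy, rfl⟩, rfl⟩
      · obtain ⟨p, a, b, c, q, hw, hR⟩ := hR h₂ (by simpa [Nat.one_le_iff_ne_zero] using hv)
        refine ⟨x :: u ++ p, a, b, c, q, by simp [hw], ?_⟩
        have hT' : Triangulates (.node () L .nil) (x :: u ++ z :: y :: []) := by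
          simpa using h₁.node_nil h₂.ends_ne hxy
        have hz : (p ++ [a]).head? = some z := by
          simpa [List.head?_append] using (congrArg List.head? hw).symm
        have hy : (c :: q).getLast? = some y := by
          simpa [List.getLast?_append, List.getLast?_cons] using (congrArg List.getLast? hw).symm
        have hux : (x :: u).length = L.numLeaves := by simpa using h₁.length_eq
        have h := graft_mem_earTrees hT' hR hz hy
        rw [List.append_nil, hux, ← add_zero L.numLeaves, graft_node_right] at h
        exact h
    · obtain ⟨p, a, b, c, q, hw, hL⟩ := hL h₁ (by simpa [Nat.one_le_iff_ne_zero] using hu)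
      refine ⟨p, a, b, c, q ++ (v ++ [y]), by simpa using congrArg (· ++ (v ++ [y])) hw, ?_⟩
      have hT' := h₂.nil_node h₁.ends_ne hxy
      have hx : (p ++ [a]).head? = some x := by
        simpa [List.head?_append] using (congrArg List.head? hw).symm
      have hz : (c :: q).getLast? = some z := by
        simpa [List.getLast?_append, List.getLast?_cons] using (congrArg List.getLast? hw).symm
      exact graft_mem_earTrees (r := []) hT' hL hx hz

/-! ### Flips -/

theorem triangulates_node_iff {L R : Tree} {p q : List α} {b : α} (hp : p.length = L.numLeaves) :
    Triangulates (.node () L R) (p ++ b :: q) ↔ Triangulates L (p ++ [b]) ∧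
      Triangulates R (b :: q) ∧ (p ++ b :: q).head? ≠ (p ++ b :: q).getLast? := by
  constructor
  · rintro ⟨p', b', q', hw, hL, hR, hne⟩
    have hp' : p.length = p'.length := by simpa [hp] using hL.length_eq.symm
    obtain ⟨rfl, hq⟩ := List.append_inj hw hp'
    obtain ⟨rfl, rfl⟩ := List.cons.inj hq
    exact ⟨hL, hR, hne⟩
  · exact fun h => ⟨p, b, q, rfl, h⟩

theorem Rotates.ne {T S : Tree} (h : Rotates T S) : T ≠ S := by
  induction h with
  | pivot A B C =>
    intro h
    have := congrArg sizeOf (BinaryTree.node.inj h).2.1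
    simp only [BinaryTree.node.sizeOf_spec] at this
    omega
  | left R _ ih => exact fun h => ih (BinaryTree.node.inj h).2.1
  | right L _ ih => exact fun h => ih (BinaryTree.node.inj h).2.2

theorem four_le_card_of_rotates [DecidableEq α] {T S : Tree} (h : Rotates T S) {w : List α}
    (hT : Triangulates T w) (hS : Triangulates S w) : 4 ≤ w.toFinset.card := by
  induction h generalizing w with
  | pivot A B C =>
    obtain ⟨x, s, c, t, d, rfl, hAB, hC, hxd⟩ := hT.exists_of_node
    obtain ⟨_, u, b, v, c', hw, hA, hB, hxc⟩ := hAB.exists_of_node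
    obtain ⟨rfl, hw⟩ := List.cons.inj hw
    replace hw : s ++ [c] = (u ++ b :: v) ++ [c'] := by simpa using hw
    obtain ⟨rfl, hc⟩ := List.append_inj' hw rfl
    obtain rfl := List.singleton_inj.1 hc
    have hbd : b ≠ d := by
      have hS' : Triangulates (.node () A (.node () B C))
          ((x :: u) ++ b :: (v ++ c :: (t ++ [d]))) := by simpa using hS
      have hBC := ((triangulates_node_iff (by simpa using hA.length_eq)).1 hS').2.1
      exact Triangulates.ends_ne (u := v ++ c :: t) (by simpa using hBC)
    have hcard : ({x, b, c, d} : Finset α).card = 4 := by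
      simp [hA.ends_ne, hB.ends_ne, hC.ends_ne, hxc, hxd, hbd]
    exact hcard ▸ Finset.card_le_card (by simp [Finset.insert_subset_iff])
  | @left L L' R h ih =>
    obtain ⟨p, b, q, rfl, hL, -⟩ := hT
    have hp : p.length = L.numLeaves := by simpa using hL.length_eq
    have hL' := ((triangulates_node_iff (hp.trans h.numLeaves_eq)).1 hS).1
    exact (ih hL hL').trans (Finset.card_le_card (by simp))
  | right L _ ih =>
    obtain ⟨p, b, q, rfl, hL, hR, -⟩ := hT
    have hR' := ((triangulates_node_iff (by simpa using hL.length_eq)).1 hS).2.1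
    exact (ih hR hR').trans (Finset.card_le_card (by simp))

/-- The flip graph of the polygon `w`: the trees whose triangulation of `w` is properly colored are
joined by an edge when they differ by a rotation, in either direction. All other trees are isolated
vertices. -/
def flipGraph (w : List α) : SimpleGraph Tree where
  Adj T S := Triangulates T w ∧ Triangulates S w ∧ (Rotates T S ∨ Rotates S T)
  symm := ⟨fun _ _ ⟨hT, hS, h⟩ => ⟨hS, hT, h.symm⟩⟩
  loopless := ⟨fun _ ⟨_, _, h⟩ => h.elim (fun h => h.ne rfl) fun h => h.ne rfl⟩

theorem reachable_graft_stock {U T S : Tree} {p q u : List α} {a b : α}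
    (hU : Triangulates U (a :: (u ++ [b]))) (h : (flipGraph (p ++ a :: b :: q)).Reachable T S) :
    (flipGraph (p ++ a :: (u ++ b :: q))).Reachable
      (graft U T p.length) (graft U S p.length) :=
  let f : flipGraph (p ++ a :: b :: q) →g flipGraph (p ++ a :: (u ++ b :: q)) :=
    { toFun := (graft U · p.length)
      map_rel' := fun ⟨hT, hS, h⟩ => ⟨triangulates_graft hT hU, triangulates_graft hS hU,
        h.imp (·.graft_stock _ _) (·.graft_stock _ _)⟩ }
  h.map f

theorem reachable_graft_scion {T U V : Tree} {p q u : List α} {a b : α}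
    (hT : Triangulates T (p ++ a :: b :: q)) (h : (flipGraph (a :: (u ++ [b]))).Reachable U V) :
    (flipGraph (p ++ a :: (u ++ b :: q))).Reachable
      (graft U T p.length) (graft V T p.length) :=
  let f : flipGraph (a :: (u ++ [b])) →g flipGraph (p ++ a :: (u ++ b :: q)) :=
    { toFun := (graft · T p.length)
      map_rel' := fun ⟨hU, hV, h⟩ => ⟨triangulates_graft hT hU, triangulates_graft hT hV,
        h.imp (·.graft_scion _ _) (·.graft_scion _ _)⟩ }
  h.map f

/-! ### Existence of triangulations -/

theorem IsPolygon.delete {p q : List α} {a b c : α} (h : IsPolygon (p ++ a :: b :: c :: q))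
    (hac : a ≠ c) : IsPolygon (p ++ a :: c :: q) := by
  refine ⟨?_, by simpa [List.head?_append, List.getLast?_append, List.getLast?_cons] using h.2⟩
  have := h.1
  simp only [List.isChain_append_cons_cons, List.isChain_cons_cons] at this ⊢
  exact ⟨this.1, hac, this.2.2.2⟩

theorem toFinset_append_cons_cons [DecidableEq α] (p q : List α) (a b : α) :
    (p ++ a :: b :: q).toFinset = insert b (p ++ a :: q).toFinset := by
  ext x
  simp only [Finset.mem_insert, List.mem_toFinset]
  grind

theorem card_le_card_delete_add_one [DecidableEq α] (p q : List α) (a b : α) :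
    (p ++ a :: b :: q).toFinset.card ≤ (p ++ a :: q).toFinset.card + 1 := by
  rw [toFinset_append_cons_cons]
  exact Finset.card_insert_le b _

theorem exists_triangulates_concat {p : List α} {b : α} (hp : p ≠ []) (hb : b ∉ p)
    (h : p.IsChain (· ≠ ·)) : ∃ T, Triangulates T (p ++ [b]) := by
  induction p with
  | nil => exact absurd rfl hp
  | cons x p ih =>
    obtain ⟨hxb, hb⟩ : b ≠ x ∧ b ∉ p := by simpa using hb
    cases p with
    | nil => exact ⟨_, triangulates_nil (Ne.symm hxb)⟩
    | cons y p =>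
      obtain ⟨hxy, h⟩ := List.isChain_cons_cons.1 h
      obtain ⟨R, hR⟩ := ih (by simp) hb h
      exact ⟨_, hR.nil_node hxy (Ne.symm hxb)⟩

theorem exists_triangulates_cons {q : List α} {b : α} (hq : q ≠ []) (hb : b ∉ q)
    (h : q.IsChain (· ≠ ·)) : ∃ T, Triangulates T (b :: q) := by
  induction q using List.reverseRecOn with
  | nil => exact absurd rfl hq
  | append_singleton q y ih =>
    obtain ⟨hb, hby⟩ : b ∉ q ∧ b ≠ y := by simpa using hb
    cases q using List.reverseRecOn with
    | nil => exact ⟨_, triangulates_nil hby⟩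
    | append_singleton q x =>
      obtain ⟨h, -, hxy⟩ := List.isChain_append.1 h
      obtain ⟨L, hL⟩ := ih (by simp) hb h
      exact ⟨_, hL.node_nil (hxy x (by simp) y (by simp)) hby⟩

theorem exists_consecutive_ne [DecidableEq α] {w : List α} (hw : 3 ≤ w.toFinset.card) :
    ∃ p a b c q, w = p ++ a :: b :: c :: q ∧ a ≠ c := by
  induction w with
  | nil => simp at hw
  | cons x w ih =>
    by_cases hx : x ∈ w
    · obtain ⟨p, a, b, c, q, rfl, hac⟩ := ih (by simpa [hx] using hw)
      exact ⟨x :: p, a, b, c, q, rfl, hac⟩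
    · match w with
      | [] | [_] => grind [List.toFinset_card_le]
      | y :: z :: q => exact ⟨[], x, y, z, q, rfl, by grind⟩

theorem IsPolygon.exists_triangulates [DecidableEq α] {w : List α} (hw : IsPolygon w)
    (h : w.length = 2 ∨ 3 ≤ w.toFinset.card) : ∃ T, Triangulates T w := by
  obtain h | hcard := h
  · obtain ⟨a, b, rfl⟩ := List.length_eq_two.1 h
    exact ⟨_, triangulates_nil (List.isChain_pair.1 hw.1)⟩
  induction hn : w.length using Nat.strong_induction_on generalizing w with
  | _ n ih =>
    obtain ⟨p, a, b, c, q, rfl, hac⟩ := exists_consecutive_ne hcard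
    obtain ⟨hp, hab, hq⟩ := List.isChain_append_cons_cons.1 hw.1
    obtain ⟨hbc, hq⟩ := List.isChain_cons_cons.1 hq
    by_cases hb : b ∈ p ++ a :: c :: q
    · rw [toFinset_append_cons_cons, Finset.insert_eq_of_mem (List.mem_toFinset.2 hb)] at hcard
      obtain ⟨T, hT⟩ := ih _ (by simp [← hn]) (hw.delete hac) hcard rfl
      exact ⟨_, Triangulates.of_mem_earTrees ⟨T, hT, rfl⟩ hab hbc⟩
    · obtain ⟨L, hL⟩ := exists_triangulates_concat (p := p ++ [a]) (b := b) (by simp) (by grind) hp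
      obtain ⟨R, hR⟩ := exists_triangulates_cons (q := c :: q) (b := b) (by simp) (by grind) hq
      exact ⟨.node () L R, p ++ [a], b, c :: q, by simp, by simpa using hL, hR, hw.2⟩

/-! ### Flipping to a deletable ear -/

theorem graft_cherry_mem_earTrees_of_left {T : Tree} {p r s : List α} {a b c x z : α}
    (hT : T ∈ earTrees (p ++ a :: r) x z s) (hr : (r ++ [x]).head? = some c) (hab : a ≠ b)
    (hbc : b ≠ c) : graft cherry T p.length ∈ earTrees (p ++ a :: b :: r) x z s := by
  obtain ⟨T, hT : Triangulates T (p ++ a :: r ++ x :: z :: s), rfl⟩ := hT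
  obtain ⟨m, hm⟩ := List.head?_eq_some_iff.1 hr
  have hw : r ++ x :: z :: s = c :: (m ++ z :: s) := by simpa using congrArg (· ++ z :: s) hm
  have hi : p.length < (p ++ a :: r).length := by simp
  have hk : (p ++ a :: r).length < T.numLeaves := by grind [hT.length_eq]
  refine ⟨graft cherry T p.length, ?_, ?_⟩
  · have h := Triangulates.of_mem_earTrees (p := p) ⟨T, by simpa [hw] using hT, rfl⟩ hab hbc
    simpa [hw] using h
  · have h := (graft_graft_comm (U := cherry) (V := cherry) hi hk).symm
    simpa [cherry, BinaryTree.numLeaves, ← add_assoc] using h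

theorem graft_cherry_mem_earTrees_of_right {T : Tree} {p q r s : List α} {a c x y z : α}
    (hT : T ∈ earTrees p a c (q ++ z :: s)) (hq : c :: q = r ++ [x]) (hxy : x ≠ y) (hyz : y ≠ z)
    (b : α) :
    graft cherry T (p ++ a :: b :: r).length ∈ earTrees p a c (q ++ y :: z :: s) := by
  obtain ⟨T, hT : Triangulates T (p ++ a :: c :: (q ++ z :: s)), rfl⟩ := hT
  have hw (t : List α) : p ++ a :: c :: (q ++ t) = p ++ a :: r ++ x :: t := by
    simpa using congrArg (p ++ a :: · ++ t) hq
  have hi : p.length < (p ++ a :: r).length := by simp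
  rw [hw] at hT
  have hk : (p ++ a :: r).length < T.numLeaves := by grind [hT.length_eq]
  refine ⟨graft cherry T (p ++ a :: r).length, ?_, ?_⟩
  · have h := Triangulates.of_mem_earTrees ⟨T, hT, rfl⟩ hxy hyz
    rwa [← hw] at h
  · have h := graft_graft_comm (U := cherry) (V := cherry) hi hk
    simpa [cherry, BinaryTree.numLeaves, ← add_assoc] using h

theorem graft_cherry_graft_cherry_mem_earTrees {T : Tree} {p q : List α} {a b d : α}
    (hT : Triangulates T (p ++ a :: d :: q)) (hab : a ≠ b) (hbd : b ≠ d) :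
    graft cherry (graft cherry T p.length) (p.length + 1) ∈ earTrees (p ++ [a]) b d q :=
  ⟨_, by simpa using Triangulates.of_mem_earTrees ⟨T, hT, rfl⟩ hab hbd, by simp⟩

theorem adj_graft_cherry_graft_cherry {T : Tree} {p q : List α} {a b c d : α}
    (hT : Triangulates T (p ++ a :: d :: q)) (hab : a ≠ b) (hbc : b ≠ c) (hcd : c ≠ d)
    (hac : a ≠ c) (hbd : b ≠ d) : (flipGraph (p ++ a :: b :: c :: d :: q)).Adj
      (graft cherry (graft cherry T p.length) p.length)
      (graft cherry (graft cherry T p.length) (p.length + 1)) := by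
  have hp : p.length < T.numLeaves := by grind [hT.length_eq]
  refine ⟨?_, ?_, .inl ?_⟩
  · exact .of_mem_earTrees ⟨_, .of_mem_earTrees ⟨T, hT, rfl⟩ hac hcd, rfl⟩ hab hbc
  · have h := graft_cherry_graft_cherry_mem_earTrees hT hab hbd
    simpa using Triangulates.of_mem_earTrees h hbc hcd
  · have h₀ := graft_graft_inside (U := cherry) (V := cherry) (k := 0) hp (by decide)
    have h₁ := graft_graft_inside (U := cherry) (V := cherry) (k := 1) hp (by decide)
    rw [add_zero] at h₀
    rw [h₀, h₁]
    exact (Rotates.pivot .nil .nil .nil).graft_scion T _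

theorem Triangulates.three_le_card [DecidableEq α] {T : Tree} {w : List α} (hT : Triangulates T w)
    (hw : 3 ≤ w.length) : 3 ≤ w.toFinset.card := by
  obtain ⟨p, a, b, c, q, rfl, hT'⟩ := hT.exists_mem_earTrees hw
  obtain ⟨hab, hbc⟩ := hT.isPolygon.ne_and_ne
  exact Finset.two_lt_card.2
    ⟨a, by simp, b, by simp, c, by simp, hab, ne_of_mem_earTrees hT', hbc⟩

theorem exists_reachable_earTrees_of_notMem {T : Tree} {p q r s : List α} {a b c x y z : α}
    (hT : Triangulates T (p ++ a :: c :: q)) (hb : b ∉ p ++ a :: c :: q)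
    (hw : p ++ a :: c :: q = r ++ x :: y :: z :: s) (hear : T ∈ earTrees r x z s) :
    ∃ r' x' z' s', p ++ a :: b :: c :: q = r' ++ x' :: y :: z' :: s' ∧
      r ++ x :: z :: s ⊆ r' ++ x' :: z' :: s' ∧ ∃ S ∈ earTrees r' x' z' s',
        (flipGraph (p ++ a :: b :: c :: q)).Reachable (graft cherry T p.length) S := by
  obtain ⟨hab, hbc⟩ : a ≠ b ∧ b ≠ c := by grind
  obtain ⟨hxy, hyz⟩ := IsPolygon.ne_and_ne (hw ▸ hT.isPolygon)
  obtain ⟨rfl, rfl, hq⟩ | ⟨m, rfl, hq⟩ | ⟨_ | ⟨y', m⟩, rfl, hq⟩ := append_cons_eq_append_cons hw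
  · obtain ⟨rfl, rfl⟩ := List.cons.inj hq
    obtain ⟨U, hU, rfl⟩ := hear
    have hbz : b ≠ z := by grind
    refine ⟨p ++ [a], b, z, s, by simp, by grind, _,
      graft_cherry_graft_cherry_mem_earTrees hU hab hbz, ?_⟩
    simpa using (adj_graft_cherry_graft_cherry hU hab hbc hyz hxy hbz).reachable
  · have hm : (m ++ [x]).head? = some c := by
      simpa [List.head?_append] using (congrArg List.head? hq).symm
    exact ⟨p ++ a :: b :: m, x, z, s, by simp [hq], by grind, _,
      graft_cherry_mem_earTrees_of_left hear hm hab hbc, .rfl⟩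
  · obtain ⟨rfl, rfl, rfl⟩ : y = a ∧ z = c ∧ s = q := by simpa using hq
    obtain ⟨U, hU, rfl⟩ := hear
    have hxb : x ≠ b := by grind
    refine ⟨r, x, b, z :: s, by simp, by grind, _,
      ⟨_, .of_mem_earTrees ⟨U, hU, rfl⟩ hxb hbc, rfl⟩, ?_⟩
    simpa using (adj_graft_cherry_graft_cherry hU hxy hab hbc hxb hyz).symm.reachable
  · obtain ⟨rfl, hm⟩ : y = y' ∧ z :: s = m ++ a :: c :: q := by simpa using hq
    obtain ⟨t, ht, rfl⟩ : ∃ t, z :: t = m ++ [a] ∧ s = t ++ c :: q := by cases m <;> simp_all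
    have hw' : m ++ a :: b :: c :: q = z :: (t ++ b :: c :: q) := by
      simpa using congrArg (· ++ b :: c :: q) ht.symm
    exact ⟨r, x, z, t ++ b :: c :: q, by simp [hw'], by grind, _,
      graft_cherry_mem_earTrees_of_right hear ht hab hbc y, .rfl⟩

theorem Triangulates.exists_reachable_earTrees [DecidableEq α] {T : Tree} {w : List α}
    (hT : Triangulates T w) (hlen : 5 ≤ w.length) (hcard : 4 ≤ w.toFinset.card) :
    ∃ p a b c q, w = p ++ a :: b :: c :: q ∧ 4 ≤ (p ++ a :: c :: q).toFinset.card ∧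
      ∃ S ∈ earTrees p a c q, (flipGraph w).Reachable T S := by
  have hdel {p q : List α} {a b c : α} (hw : 4 ≤ (p ++ a :: b :: c :: q).toFinset.card)
      (hb : b ∈ p ++ a :: c :: q) : 4 ≤ (p ++ a :: c :: q).toFinset.card := by
    rwa [toFinset_append_cons_cons, Finset.insert_eq_of_mem (List.mem_toFinset.2 hb)] at hw
  obtain ⟨p, a, b, c, q, rfl, hmem⟩ := hT.exists_mem_earTrees (by omega)
  by_cases hcard₀ : 4 ≤ (p ++ a :: c :: q).toFinset.card
  · exact ⟨p, a, b, c, q, rfl, hcard₀, T, hmem, .rfl⟩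
  obtain ⟨T₀, hT₀ : Triangulates T₀ _, rfl⟩ := hmem
  obtain ⟨r, x, y, z, s, hw, hear⟩ := hT₀.exists_mem_earTrees (by grind)
  have hy : y ∈ r ++ x :: z :: s := by
    by_contra hy
    obtain ⟨T', hT' : Triangulates T' _, -⟩ := hear
    have h := hT'.three_le_card (by grind [congrArg List.length hw])
    rw [hw, toFinset_append_cons_cons,
      Finset.card_insert_of_notMem (List.mem_toFinset.not.2 hy)] at hcard₀
    omega
  obtain ⟨r', x', z', s', hw', hsub, hS⟩ :=
    exists_reachable_earTrees_of_notMem hT₀ (fun hb => hcard₀ (hdel hcard hb)) hw hear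
  exact ⟨r', x', y, z', s', hw', hdel (hw' ▸ hcard) (hsub hy), hS⟩

/-! ### Exchanging two ears -/

/-- In the polygon `p ++ a :: b :: c :: d :: q`, flips lead from some triangulation with ear `b` to
some triangulation with ear `c`. -/
def EarsLinked (p : List α) (a b c d : α) (q : List α) : Prop :=
  ∃ T ∈ earTrees p a c (d :: q), ∃ S ∈ earTrees (p ++ [a]) b d q,
    (flipGraph (p ++ a :: b :: c :: d :: q)).Reachable T S

theorem EarsLinked.graft {T : Tree} {p q r s : List α} {a b c d x y : α}
    (h : EarsLinked p a b c d q) (hT : Triangulates T (r ++ x :: y :: s))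
    (hx : (p ++ [a]).head? = some x) (hy : (d :: q).getLast? = some y) :
    EarsLinked (r ++ p) a b c d (q ++ s) := by
  obtain ⟨U, hU, V, hV, h⟩ := h
  obtain ⟨p', hp⟩ := List.head?_eq_some_iff.1 hx
  obtain ⟨q', hq⟩ := List.getLast?_eq_some_iff.1 hy
  have hw : p ++ a :: b :: c :: d :: q = x :: ((p' ++ b :: c :: q') ++ [y]) := by
    simpa [hq] using congrArg (· ++ b :: c :: d :: q) hp
  have hw' : r ++ x :: (p' ++ b :: c :: q' ++ y :: s) =
      r ++ p ++ a :: b :: c :: d :: (q ++ s) := by simpa using congrArg (r ++ · ++ s) hw.symm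
  refine ⟨_, graft_mem_earTrees hT hU hx (by simpa [List.getLast?_cons] using hy),
    ColoredTree.graft V T r.length, ?_, hw' ▸ reachable_graft_scion hT (hw ▸ h)⟩
  rw [List.append_assoc]
  exact graft_mem_earTrees hT hV (by simp [hp]) hy

theorem earsLinked_of_ne {T : Tree} {p q : List α} {a b c d : α}
    (hT : Triangulates T (p ++ a :: d :: q)) (hab : a ≠ b) (hbc : b ≠ c) (hcd : c ≠ d)
    (hac : a ≠ c) (hbd : b ≠ d) : EarsLinked p a b c d q := by
  have h := adj_graft_cherry_graft_cherry hT hab hbc hcd hac hbd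
  exact ⟨_, ⟨_, .of_mem_earTrees ⟨T, hT, rfl⟩ hac hcd, rfl⟩, _,
    graft_cherry_graft_cherry_mem_earTrees hT hab hbd, h.reachable⟩

theorem earsLinked_fan_left {L : Tree} {u : List α} {a b c e : α}
    (hL : Triangulates L (e :: (u ++ [a]))) (hab : a ≠ b) (hbc : b ≠ c) (hca : c ≠ a)
    (heb : e ≠ b) (hec : e ≠ c) : EarsLinked (e :: u) a b c a [] := by
  have hu : u.length + 1 = L.numLeaves := by simpa using hL.length_eq
  have hea := hL.ends_ne
  have hear₁ : .node () (.node () L cherry) .nil ∈ earTrees (e :: u) a c [a] := by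
    refine ⟨_, by simpa using (hL.node_nil hca.symm hec).node_nil hca hea, ?_⟩
    simp [hu, graft, BinaryTree.numLeaves]
  have hear₂ : .node () (.node () L .nil) cherry ∈ earTrees (e :: u ++ [a]) b a [] := by
    refine ⟨_, by simpa using (hL.node_nil hab heb).node_nil hab.symm hea, ?_⟩
    simp [hu, graft, BinaryTree.numLeaves]
  have h₀ : Triangulates (.node () (.node () (.node () L .nil) .nil) .nil)
      (e :: u ++ [a, b, c, a]) := by
    simpa using ((hL.node_nil hab heb).node_nil hbc hec).node_nil hca hea
  have h₁ := Triangulates.of_mem_earTrees hear₁ hab hbc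
  have h₂ := Triangulates.of_mem_earTrees hear₂ hbc hca
  rw [List.append_assoc] at h₂
  have adj₁ : (flipGraph (e :: u ++ [a, b, c, a])).Adj _ _ :=
    ⟨h₀, h₁, .inl (.left _ (.pivot _ _ _))⟩
  have adj₂ : (flipGraph (e :: u ++ [a, b, c, a])).Adj _ _ := ⟨h₀, h₂, .inl (.pivot _ _ _)⟩
  exact ⟨_, hear₁, _, hear₂, adj₁.symm.reachable.trans adj₂.reachable⟩

theorem earsLinked_fan_right {R : Tree} {u : List α} {a b c e : α}
    (hR : Triangulates R (a :: (u ++ [e]))) (hab : a ≠ b) (hbc : b ≠ c) (hca : c ≠ a)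
    (heb : e ≠ b) (hec : e ≠ c) : EarsLinked [] a b c a (u ++ [e]) := by
  have hae := hR.ends_ne
  have hear₁ : .node () cherry (.node () .nil R) ∈ earTrees [] a c (a :: (u ++ [e])) := by
    refine ⟨_, by simpa using (hR.nil_node hca hec.symm).nil_node hca.symm hae, ?_⟩
    simp [graft, BinaryTree.numLeaves]
  have hear₂ : .node () .nil (.node () cherry R) ∈ earTrees [a] b a (u ++ [e]) := by
    refine ⟨_, by simpa using (hR.nil_node hab.symm heb.symm).nil_node hab hae, ?_⟩
    simp [graft, BinaryTree.numLeaves]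
  have h₀ : Triangulates (.node () .nil (.node () .nil (.node () .nil R)))
      (a :: b :: c :: a :: (u ++ [e])) := by
    simpa using ((hR.nil_node hca hec.symm).nil_node hbc heb.symm).nil_node hab hae
  have h₁ := Triangulates.of_mem_earTrees hear₁ hab hbc
  have h₂ := Triangulates.of_mem_earTrees hear₂ hbc hca
  have adj₁ : (flipGraph (a :: b :: c :: a :: (u ++ [e]))).Adj _ _ := ⟨h₁, h₀, .inl (.pivot _ _ _)⟩
  have adj₂ : (flipGraph (a :: b :: c :: a :: (u ++ [e]))).Adj _ _ :=
    ⟨h₂, h₀, .inl (.right _ (.pivot _ _ _))⟩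
  exact ⟨_, hear₁, _, hear₂, adj₁.reachable.trans adj₂.symm.reachable⟩

theorem exists_mem_notMem_of_four_le_card [DecidableEq α] {l : List α} {a c : α}
    (h : 4 ≤ (a :: c :: l).toFinset.card) (b : α) : ∃ e ∈ l, e ∉ [a, b, c] := by
  have hlt : [a, b, c].toFinset.card < (a :: c :: l).toFinset.card :=
    (List.toFinset_card_le _).trans_lt h
  obtain ⟨e, he, hne⟩ := Finset.exists_mem_notMem_of_card_lt_card hlt
  rw [List.mem_toFinset] at he hne
  grind

theorem exists_append_cons_three_le_card [DecidableEq α] {l : List α} {a c : α}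
    (hhead : l.head? ≠ some a) (hlast : l.getLast? ≠ some a)
    (hcard : 4 ≤ (a :: c :: l).toFinset.card) (b : α) :
    ∃ u e v, l = u ++ e :: v ∧ e ∉ [a, b, c] ∧
      (u = [] ∨ 3 ≤ (a :: (u ++ [e])).toFinset.card) ∧
      (v = [] ∨ 3 ≤ (e :: (v ++ [a])).toFinset.card) := by
  have hal : 3 ≤ (a :: l).toFinset.card :=
    Nat.le_of_succ_le_succ (hcard.trans (card_le_card_delete_add_one [] l a c))
  -- An end of `l` with a color other than `b`, `c` may serve as `e`; if both ends have color `b`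
  -- or `c`, they are the third color next to `a` and `e`.
  by_cases hlast' : ∀ z ∈ l.getLast?, z ∈ [b, c]
  · by_cases hhead' : ∀ y ∈ l.head?, y ∈ [b, c]
    · obtain ⟨e, hel, he⟩ := exists_mem_notMem_of_four_le_card hcard b
      obtain ⟨u, v, rfl⟩ := List.append_of_mem hel
      refine ⟨u, e, v, rfl, he, ?_, ?_⟩
      · cases u with
        | nil => exact .inl rfl
        | cons y u =>
          obtain ⟨hay, hae, hye⟩ : a ≠ y ∧ a ≠ e ∧ y ≠ e := by grind [hhead' y rfl]
          exact .inr (Finset.two_lt_card.2 ⟨a, by simp, y, by simp, e, by simp, hay, hae, hye⟩)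
      · obtain rfl | ⟨v, z, rfl⟩ := v.eq_nil_or_concat
        · exact .inl rfl
        · obtain ⟨haz, hae, hze⟩ : a ≠ z ∧ a ≠ e ∧ z ≠ e := by
            grind [hlast' z (by simp [List.getLast?_append, List.getLast?_cons])]
          exact .inr (Finset.two_lt_card.2 ⟨a, by simp, z, by simp, e, by simp, haz, hae, hze⟩)
    · push Not at hhead'
      obtain ⟨y, hy, hybc⟩ := hhead'
      obtain ⟨v, rfl⟩ := List.head?_eq_some_iff.1 hy
      have hset : (a :: y :: v).toFinset = (y :: (v ++ [a])).toFinset := by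
        grind [List.mem_toFinset]
      exact ⟨[], y, v, rfl, by grind, .inl rfl, .inr (hset ▸ hal)⟩
  · push Not at hlast'
    obtain ⟨z, hz, hzbc⟩ := hlast'
    obtain ⟨u, rfl⟩ := List.getLast?_eq_some_iff.1 hz
    exact ⟨u, z, [], rfl, by grind, .inr hal, .inl rfl⟩

theorem earsLinked_of_left [DecidableEq α] {p q u : List α} {a b c e : α}
    (hw : IsPolygon (p ++ e :: u ++ a :: b :: c :: a :: q)) (he : e ∉ [a, b, c])
    (hu : u = [] ∨ 3 ≤ (e :: (u ++ [a])).toFinset.card)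
    (hpq : p ++ q = [] ∨ 3 ≤ (p ++ e :: a :: q).toFinset.card) :
    EarsLinked (p ++ e :: u) a b c a q := by
  obtain ⟨hea, heb, hec⟩ : e ≠ a ∧ e ≠ b ∧ e ≠ c := by simpa using he
  obtain ⟨hp, hab, hbc, hca, hq⟩ : (p ++ e :: u ++ [a]).IsChain (· ≠ ·) ∧ a ≠ b ∧ b ≠ c ∧ c ≠ a ∧
      (a :: q).IsChain (· ≠ ·) := by
    simpa only [List.isChain_append_cons_cons, List.isChain_cons_cons] using hw.1
  rw [List.append_assoc, List.cons_append, List.isChain_split] at hp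
  obtain ⟨L, hL⟩ := IsPolygon.exists_triangulates (w := e :: (u ++ [a]))
    ⟨hp.2, by simpa [List.getLast?_cons] using hea⟩ (hu.imp (by simp +contextual) id)
  obtain ⟨T, hT⟩ := IsPolygon.exists_triangulates (w := p ++ e :: a :: q)
    ⟨List.isChain_append_cons_cons.2 ⟨hp.1, hea, hq⟩,
      by simpa [List.head?_append, List.getLast?_append, List.getLast?_cons] using hw.2⟩
    (hpq.imp (by simp +contextual) id)
  exact (earsLinked_fan_left hL hab hbc hca heb hec).graft hT rfl rfl

theorem earsLinked_of_right [DecidableEq α] {p q u : List α} {a b c e : α}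
    (hw : IsPolygon (p ++ a :: b :: c :: a :: (u ++ e :: q))) (he : e ∉ [a, b, c])
    (hu : u = [] ∨ 3 ≤ (a :: (u ++ [e])).toFinset.card)
    (hpq : p ++ q = [] ∨ 3 ≤ (p ++ a :: e :: q).toFinset.card) :
    EarsLinked p a b c a (u ++ e :: q) := by
  obtain ⟨hea, heb, hec⟩ : e ≠ a ∧ e ≠ b ∧ e ≠ c := by simpa using he
  obtain ⟨hp, hab, hbc, hca, hq⟩ : (p ++ [a]).IsChain (· ≠ ·) ∧ a ≠ b ∧ b ≠ c ∧ c ≠ a ∧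
      (a :: (u ++ e :: q)).IsChain (· ≠ ·) := by
    simpa only [List.isChain_append_cons_cons, List.isChain_cons_cons] using hw.1
  rw [← List.cons_append, List.isChain_split] at hq
  obtain ⟨R, hR⟩ := IsPolygon.exists_triangulates (w := a :: (u ++ [e]))
    ⟨hq.1, by simpa [List.getLast?_cons] using hea.symm⟩ (hu.imp (by simp +contextual) id)
  obtain ⟨T, hT⟩ := IsPolygon.exists_triangulates (w := p ++ a :: e :: q)
    ⟨List.isChain_append_cons_cons.2 ⟨hp, hea.symm, hq.2⟩,
      by simpa [List.head?_append, List.getLast?_append, List.getLast?_cons] using hw.2⟩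
    (hpq.imp (by simp +contextual) id)
  have h := (earsLinked_fan_right hR hab hbc hca heb hec).graft hT rfl
    (by simp [List.getLast?_cons])
  simpa using h

theorem IsPolygon.head?_ne_and_getLast?_ne {p l q : List α} {a : α}
    (hw : IsPolygon (p ++ a :: (l ++ a :: q))) :
    (q ++ p).head? ≠ some a ∧ (q ++ p).getLast? ≠ some a := by
  obtain ⟨hchain, hends⟩ := hw
  constructor
  · cases q with
    | nil => cases p <;> simp_all [List.getLast?_append, List.getLast?_cons]
    | cons y q =>
      have h := hchain.right_of_append
      rw [← List.cons_append, List.isChain_append_cons_cons] at h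
      simpa using h.2.1.symm
  · cases p using List.reverseRecOn with
    | nil => cases q using List.reverseRecOn <;> simp_all [List.getLast?_cons, eq_comm]
    | append_singleton p z =>
      rw [List.append_assoc, List.singleton_append, List.isChain_append_cons_cons] at hchain
      simpa [List.getLast?_append] using hchain.2.1

theorem earsLinked_pinched [DecidableEq α] {p q : List α} {a b c : α}
    (hw : IsPolygon (p ++ a :: b :: c :: a :: q))
    (hcard : 4 ≤ (p ++ a :: c :: a :: q).toFinset.card) : EarsLinked p a b c a q := by
  have hset : (p ++ a :: c :: a :: q).toFinset = (a :: c :: (q ++ p)).toFinset := by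
    grind [List.mem_toFinset]
  obtain ⟨hhead, hlast⟩ := IsPolygon.head?_ne_and_getLast?_ne (l := [b, c]) hw
  obtain ⟨u, e, v, huv, he, hu, hv⟩ :=
    exists_append_cons_three_le_card hhead hlast (hset ▸ hcard) b
  obtain ⟨m, rfl, rfl⟩ | ⟨m, rfl, rfl⟩ : (∃ m, p = m ++ e :: v ∧ u = q ++ m) ∨
      ∃ m, q = u ++ e :: m ∧ v = m ++ p := by
    obtain ⟨m, rfl, rfl⟩ | ⟨_ | ⟨_, m⟩, rfl, h⟩ := List.append_eq_append_iff.1 huv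
    · exact .inl ⟨m, rfl, rfl⟩
    · exact .inl ⟨[], by simpa using h.symm, by simp⟩
    · obtain ⟨rfl, rfl⟩ := List.cons.inj h
      exact .inr ⟨m, rfl, rfl⟩
  · refine earsLinked_of_left hw he hv (hu.imp (by simp +contextual) fun h => ?_)
    refine h.trans_eq (congrArg Finset.card (List.toFinset.ext fun x => ?_))
    simp only [List.mem_append, List.mem_cons, List.not_mem_nil, or_false]
    tauto
  · refine earsLinked_of_right hw he hu (hv.imp (by simp +contextual) fun h => ?_)
    refine h.trans_eq (congrArg Finset.card (List.toFinset.ext fun x => ?_))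
    simp only [List.mem_append, List.mem_cons, List.not_mem_nil, or_false]
    tauto

theorem earsLinked [DecidableEq α] {p q : List α} {a b c d : α}
    (hw : IsPolygon (p ++ a :: b :: c :: d :: q)) (hac : a ≠ c) (hbd : b ≠ d)
    (hcard : 4 ≤ (p ++ a :: c :: d :: q).toFinset.card) : EarsLinked p a b c d q := by
  obtain rfl | had := eq_or_ne a d
  · exact earsLinked_pinched hw hcard
  · have hcard' := hcard.trans (card_le_card_delete_add_one p (d :: q) a c)
    obtain ⟨T, hT⟩ := ((hw.delete hac).delete had).exists_triangulates (.inr (by omega))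
    obtain ⟨hab, hbc⟩ := hw.ne_and_ne
    obtain ⟨-, hcd⟩ := IsPolygon.ne_and_ne (p := p ++ [a]) (by simpa using hw)
    exact earsLinked_of_ne hT hab hbc hcd hac hbd

theorem nonempty_earTrees_inter [DecidableEq α] {p q r s : List α} {a b c x y z : α}
    (hw : IsPolygon (p ++ a :: b :: c :: q)) (hq : c :: q = r ++ x :: y :: z :: s) (hac : a ≠ c)
    (hxz : x ≠ z) (hcard : 4 ≤ (p ++ a :: c :: q).toFinset.card) :
    (earTrees p a c q ∩ earTrees (p ++ a :: b :: r) x z s).Nonempty := by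
  have hr : (r ++ [x]).head? = some c := by
    simpa [List.head?_append] using (congrArg List.head? hq).symm
  have hb : IsPolygon (p ++ a :: r ++ x :: y :: z :: s) := by simpa [hq] using hw.delete hac
  obtain ⟨hab, hbc⟩ := hw.ne_and_ne
  obtain ⟨hxy, hyz⟩ := hb.ne_and_ne
  have hcard' := card_le_card_delete_add_one (p ++ a :: r) (z :: s) x y
  obtain ⟨T, hT⟩ := (hb.delete hxz).exists_triangulates (.inr (by grind))
  have hTy : graft cherry T (p ++ a :: r).length ∈ earTrees (p ++ a :: r) x z s := ⟨T, hT, rfl⟩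
  refine ⟨_, ⟨_, ?_, rfl⟩, graft_cherry_mem_earTrees_of_left hTy hr hab hbc⟩
  simpa [hq] using Triangulates.of_mem_earTrees hTy hxy hyz

theorem exists_reachable_earTrees_earTrees [DecidableEq α] {p q r s : List α} {a b c x y z : α}
    (hw : IsPolygon (p ++ a :: b :: c :: q))
    (h : p ++ a :: b :: c :: q = r ++ x :: y :: z :: s)
    (hac : a ≠ c) (hxz : x ≠ z) (hb : 4 ≤ (p ++ a :: c :: q).toFinset.card)
    (hy : 4 ≤ (r ++ x :: z :: s).toFinset.card) :
    ∃ T ∈ earTrees p a c q, ∃ S ∈ earTrees r x z s,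
      (flipGraph (p ++ a :: b :: c :: q)).Reachable T S := by
  wlog hpr : p.length ≤ r.length generalizing p q r s a b c x y z
  · obtain ⟨T, hT, S, hS, hTS⟩ := this (h ▸ hw) h.symm hxz hac hy hb (by omega)
    exact ⟨S, hS, T, hT, h ▸ hTS.symm⟩
  obtain ⟨rfl, rfl, h'⟩ | ⟨_ | ⟨b', m⟩, rfl, h'⟩ | ⟨m, rfl, -⟩ := append_cons_eq_append_cons h
  · obtain ⟨rfl, rfl, rfl⟩ : b = y ∧ c = z ∧ q = s := by simpa using h'
    obtain ⟨T, hT⟩ := (hw.delete hac).exists_triangulates (.inr (by omega))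
    exact ⟨_, ⟨T, hT, rfl⟩, _, ⟨T, hT, rfl⟩, .rfl⟩
  · obtain ⟨rfl, rfl, rfl⟩ : b = x ∧ c = y ∧ q = z :: s := by simpa using h'
    exact earsLinked hw hac hxz hb
  · obtain ⟨rfl, hq⟩ := List.cons.inj h'
    obtain ⟨T, hT, hT'⟩ := nonempty_earTrees_inter hw hq hac hxz hb
    exact ⟨T, hT, T, hT', .rfl⟩
  · simp at hpr

theorem Triangulates.eq_cherry {T : Tree} {w : List α} (hT : Triangulates T w)
    (hw : w.length = 3) : T = cherry := by
  obtain ⟨p, a, b, c, q, rfl, U, hU, rfl⟩ := hT.exists_mem_earTrees hw.ge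
  simp only [List.length_append, List.length_cons] at hw
  obtain rfl := Triangulates.eq_nil hU (by simp; omega)
  simp [graft]

theorem Triangulates.eq_graft_cherry_cherry {T : Tree} {w : List α} (hT : Triangulates T w)
    (hw : w.length = 4) : T = graft cherry cherry 0 ∨ T = graft cherry cherry 1 := by
  obtain ⟨p, a, b, c, q, rfl, U, hU, rfl⟩ := hT.exists_mem_earTrees (by omega)
  simp only [List.length_append, List.length_cons] at hw
  obtain rfl := Triangulates.eq_cherry hU (by simp; omega)
  obtain hp | hp : p.length = 0 ∨ p.length = 1 := by omega
  · exact .inl (by simp [hp])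
  · exact .inr (by simp [hp])

theorem Triangulates.reachable_of_length_eq_four [DecidableEq α] {w : List α} {T S : Tree}
    (hT : Triangulates T w) (hS : Triangulates S w) (hlen : w.length = 4)
    (hcard : 4 ≤ w.toFinset.card) : (flipGraph w).Reachable T S := by
  have hnodup : w.Nodup := Multiset.coe_nodup.1 <|
    Multiset.toFinset_card_eq_card_iff_nodup.1 (w.toFinset_card_le.antisymm (hlen ▸ hcard))
  have hcases := hT.eq_graft_cherry_cherry hlen
  have hcases' := hS.eq_graft_cherry_cherry hlen
  obtain ⟨a, b, c, d, rfl⟩ := List.length_eq_four.1 hlen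
  obtain ⟨⟨hab, hac, had⟩, ⟨hbc, hbd⟩, hcd⟩ :
      (a ≠ b ∧ a ≠ c ∧ a ≠ d) ∧ (b ≠ c ∧ b ≠ d) ∧ c ≠ d := by simpa using hnodup
  have hadj : (flipGraph [a, b, c, d]).Adj (graft cherry cherry 0) (graft cherry cherry 1) :=
    adj_graft_cherry_graft_cherry (p := []) (triangulates_nil had) hab hbc hcd hac hbd
  obtain rfl | rfl := hcases <;> obtain rfl | rfl := hcases'
  exacts [.rfl, hadj.reachable, hadj.symm.reachable, .rfl]

theorem Triangulates.reachable [DecidableEq α] {w : List α} {T S : Tree} (hT : Triangulates T w)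
    (hS : Triangulates S w) (hcard : 4 ≤ w.toFinset.card) : (flipGraph w).Reachable T S := by
  induction hn : w.length using Nat.strong_induction_on generalizing w T S with
  | _ n ih =>
    obtain hlen | hlen := (hcard.trans w.toFinset_card_le).eq_or_lt
    · exact hT.reachable_of_length_eq_four hS hlen.symm hcard
    have hw := hT.isPolygon
    have hear {p q : List α} {a b c : α} {U V : Tree} (hpq : w = p ++ a :: b :: c :: q)
        (hU : U ∈ earTrees p a c q) (hV : V ∈ earTrees p a c q)
        (hb : 4 ≤ (p ++ a :: c :: q).toFinset.card) : (flipGraph w).Reachable U V := by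
      subst hpq
      obtain ⟨hab, hbc⟩ := hw.ne_and_ne
      have hcherry := triangulates_cherry hab hbc (ne_of_mem_earTrees hU)
      obtain ⟨U, hU, rfl⟩ := hU
      obtain ⟨V, hV, rfl⟩ := hV
      exact reachable_graft_stock (u := [b]) hcherry (ih _ (by simp [← hn]) hU hV hb rfl)
    obtain ⟨p, a, b, c, q, hpq, hb, T', hT', hTT'⟩ := hT.exists_reachable_earTrees hlen hcard
    obtain ⟨r, x, y, z, s, hrs, hy, S', hS', hSS'⟩ := hS.exists_reachable_earTrees hlen hcard
    obtain ⟨U, hU, V, hV, hUV⟩ := exists_reachable_earTrees_earTrees (hpq ▸ hw)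
      (hpq.symm.trans hrs) (ne_of_mem_earTrees hT') (ne_of_mem_earTrees hS') hb hy
    exact hTT'.trans <| (hear hpq hT' hU hb).trans <| (hpq ▸ hUV).trans <|
      (hear hrs hV hS' hy).trans hSS'.symm

end Polygon

/-! ### Edge colors as sums of vertex colors -/

/-- The colors of the edges of `T` under `κ` sum to zero at each vertex of degree three. -/
def IsZeroSum (T : Tree) (κ : Address → Color) : Prop :=
  ∀ u ∈ internals T, κ u + κ (u ++ [false]) + κ (u ++ [true]) = 0

theorem length_leaves (T : Tree) : (leaves T).length = T.numLeaves := by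
  induction T with
  | nil => rfl
  | node _ L R hL hR => simp [leaves, BinaryTree.numLeaves, hL, hR]

theorem forall_mem_internals_node {L R : Tree} {P : Address → Prop} :
    (∀ u ∈ internals (.node () L R), P u) ↔ P [] ∧ (∀ u ∈ internals L, P (false :: u)) ∧
      ∀ u ∈ internals R, P (true :: u) := by
  simp [internals, or_imp, forall_and]

theorem forall_mem_edges_node {L R : Tree} {P : Address → Prop} :
    (∀ e ∈ edges (.node () L R), P e) ↔ P [] ∧ (∀ e ∈ edges L, P (false :: e)) ∧
      ∀ e ∈ edges R, P (true :: e) := by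
  simp only [edges, leaves, Set.mem_ofPred_eq, or_imp, forall_and, forall_mem_internals_node,
    List.forall_mem_append, List.forall_mem_map]
  tauto

theorem nil_mem_edges (T : Tree) : [] ∈ edges T := by
  cases T <;> simp [edges, leaves, internals]

theorem isZeroSum_node {L R : Tree} {κ : Address → Color} :
    IsZeroSum (.node () L R) κ ↔ κ [] = κ [false] + κ [true] ∧
      IsZeroSum L (κ ∘ List.cons false) ∧ IsZeroSum R (κ ∘ List.cons true) := by
  refine forall_mem_internals_node.trans (and_congr_left' ?_)
  rw [add_assoc, CharTwo.add_eq_zero]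
  rfl

theorem IsZeroSum.sum_leaves {T : Tree} {κ : Address → Color} (h : IsZeroSum T κ) :
    ((leaves T).map κ).sum = κ [] := by
  induction T generalizing κ with
  | nil => simp [leaves]
  | node _ L R hL hR =>
    obtain ⟨h, h₀, h₁⟩ := isZeroSum_node.1 h
    simp [leaves, hL h₀, hR h₁, h]

theorem isProper_node_iff {L R : Tree} {κ : Address → Color} (h : κ [] = κ [false] + κ [true]) :
    IsProper (.node () L R) κ ↔
      IsProper L (κ ∘ List.cons false) ∧ IsProper R (κ ∘ List.cons true) ∧ κ [] ≠ 0 := by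
  constructor
  · rintro ⟨hne, hdist⟩
    obtain ⟨hne, hne₀, hne₁⟩ := forall_mem_edges_node.1 hne
    obtain ⟨-, hdist₀, hdist₁⟩ := forall_mem_internals_node.1 hdist
    exact ⟨⟨hne₀, hdist₀⟩, ⟨hne₁, hdist₁⟩, hne⟩
  · rintro ⟨h₀, h₁, hne⟩
    have hne₀ : κ [false] ≠ 0 := h₀.ne_zero [] (nil_mem_edges L)
    have hne₁ : κ [true] ≠ 0 := h₁.ne_zero [] (nil_mem_edges R)
    have hdist : κ [] ≠ κ [false] ∧ κ [] ≠ κ [true] ∧ κ [false] ≠ κ [true] := by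
      rw [h] at hne ⊢
      exact ⟨by simpa, by simpa, fun heq => hne (CharTwo.add_eq_zero.2 heq)⟩
    exact ⟨forall_mem_edges_node.2 ⟨hne, h₀.ne_zero, h₁.ne_zero⟩,
      forall_mem_internals_node.2 ⟨hdist, h₀.distinct, h₁.distinct⟩⟩

theorem exists_scanl_add_append {G : Type*} [AddMonoid G] (l l' : List G) (x : G) : ∃ p q,
    l.scanl (· + ·) x = p ++ [x + l.sum] ∧ l'.scanl (· + ·) (x + l.sum) = (x + l.sum) :: q ∧
      (l ++ l').scanl (· + ·) x = p ++ (x + l.sum) :: q := by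
  induction l generalizing x with
  | nil => cases l' <;> simp
  | cons a l ih =>
    obtain ⟨p, q, hp, hq, hpq⟩ := ih (x + a)
    exact ⟨x :: p, q, by simpa [add_assoc] using hp, by simpa [add_assoc] using hq,
      by simpa [add_assoc] using hpq⟩

theorem head?_scanl_add_ne_getLast?_iff {G : Type*} [AddGroup G] {l : List G} {x : G} :
    (l.scanl (· + ·) x).head? ≠ (l.scanl (· + ·) x).getLast? ↔ l.sum ≠ 0 := by
  obtain ⟨p, q, hp, -⟩ := exists_scanl_add_append l [] x
  rw [List.head?_scanl, hp]
  simp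

theorem triangulates_scanl_add_iff {T : Tree} {κ : Address → Color} (h : IsZeroSum T κ)
    (x : Color) : Triangulates T (((leaves T).map κ).scanl (· + ·) x) ↔ IsProper T κ := by
  induction T generalizing κ x with
  | nil =>
    have hproper : IsProper .nil κ ↔ κ [] ≠ 0 :=
      ⟨fun h => h.ne_zero [] (nil_mem_edges _), fun h =>
        ⟨by simpa [edges, leaves, internals], by simp [internals]⟩⟩
    rw [hproper]
    constructor
    · intro h
      simpa [leaves] using h.isPolygon.2
    · intro h
      exact triangulates_nil (y := x + κ []) (by simpa using h)
  | node _ L R hL hR =>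
    have hsum := h.sum_leaves
    obtain ⟨h, h₀, h₁⟩ := isZeroSum_node.1 h
    obtain ⟨p, q, hp, hq, hpq⟩ := exists_scanl_add_append
      ((leaves L).map (κ ∘ List.cons false)) ((leaves R).map (κ ∘ List.cons true)) x
    have hw : ((leaves (.node () L R)).map κ).scanl (· + ·) x = p ++ (x + κ [false]) :: q := by
      simpa [leaves, h₀.sum_leaves] using hpq
    rw [h₀.sum_leaves] at hp hq
    have hlen : p.length = L.numLeaves := by
      simpa [length_leaves] using (congrArg List.length hp).symm
    rw [isProper_node_iff h, ← hL h₀ x, ← hR h₁ _, ← hsum,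
      ← head?_scanl_add_ne_getLast?_iff (x := x), hw, hp, hq]
    exact triangulates_node_iff hlen

/-- The colors of the vertices of the polygon whose sides have the colors `c`, normalized to start
with `0`: the color of a side is the sum of the colors of its ends. -/
def vertexColors {n : ℕ} (c : Fin n → Color) : List Color := (List.ofFn c).scanl (· + ·) 0

theorem valid_iff_triangulates {n : ℕ} {T : Tree} {c : Fin n → Color} :
    Valid T c ↔ Triangulates T (vertexColors c) := by
  constructor
  · rintro ⟨κ, ⟨hleaf, hsum⟩, hκ⟩
    rw [vertexColors, ← hleaf]
    exact (triangulates_scanl_add_iff hsum 0).2 hκ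
  · intro h
    obtain ⟨κ, hleaf, hsum⟩ :=
      exists_coloring T (List.ofFn c) (by simpa [vertexColors] using h.length_eq)
    rw [vertexColors, ← hleaf] at h
    exact ⟨κ, ⟨hleaf, hsum⟩, (triangulates_scanl_add_iff hsum 0).1 h⟩

theorem colorGraph_adj {d : ℕ} {c : Fin (d + 2) → Color}
    {T S : {T : {T : Tree // T.numLeaves = d + 2} | Valid T.1 c}} :
    (colorGraph c).Adj T S ↔ (flipGraph (vertexColors c)).Adj T.1.1 S.1.1 := by
  have hT := valid_iff_triangulates.1 T.2
  have hS := valid_iff_triangulates.1 S.2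
  have hne (h : Rotates T.1.1 S.1.1 ∨ Rotates S.1.1 T.1.1) : T.1 ≠ S.1 := fun heq =>
    h.elim (fun h => h.ne (congrArg _ heq)) fun h => h.ne (congrArg _ heq.symm)
  simpa [colorGraph, associahedron, flipGraph, hT, hS] using hne

theorem colorGraph_reachable {d : ℕ} {c : Fin (d + 2) → Color}
    {T S : {T : {T : Tree // T.numLeaves = d + 2} | Valid T.1 c}}
    (h : (flipGraph (vertexColors c)).Reachable T.1.1 S.1.1) : (colorGraph c).Reachable T S := by
  obtain ⟨walk⟩ := h
  generalize hT : T.1.1 = U, hS : S.1.1 = V at walk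
  induction walk generalizing T with
  | nil => rw [Subtype.ext (Subtype.ext (hT.trans hS.symm))]
  | @cons _ U _ hadj _ ih =>
    have hU := hadj.2.1
    have hlen : U.numLeaves = d + 2 := by simpa [vertexColors] using hU.length_eq.symm
    let U' : {T : {T : Tree // T.numLeaves = d + 2} | Valid T.1 c} :=
      ⟨⟨U, hlen⟩, valid_iff_triangulates.2 hU⟩
    have hTU : (colorGraph c).Adj T U' := colorGraph_adj.2 (hT ▸ hadj)
    exact hTU.reachable.trans (ih rfl hS)

end ColoredTree

theorem theorem6p2 (d : ℕ) (c : Fin (d + 2) → ColoredTree.Color)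
    (hc : ColoredTree.Acceptable c) :
    (ColoredTree.colorGraph c).Connected ∨ (ColoredTree.colorGraph c).edgeSet = ∅ := by
  by_cases hcard : 4 ≤ (ColoredTree.vertexColors c).toFinset.card
  · obtain ⟨T, hT⟩ := hc
    have hlen : T.numLeaves = d + 2 := by
      simpa [ColoredTree.vertexColors] using
        (ColoredTree.valid_iff_triangulates.1 hT).length_eq.symm
    refine .inl ((SimpleGraph.connected_iff _).2 ⟨fun T S => ?_, ⟨⟨⟨T, hlen⟩, hT⟩⟩⟩)
    exact ColoredTree.colorGraph_reachable <| (ColoredTree.valid_iff_triangulates.1 T.2).reachable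
      (ColoredTree.valid_iff_triangulates.1 S.2) hcard
  · refine .inr (SimpleGraph.edgeSet_eq_empty.2 (SimpleGraph.eq_bot_iff_forall_not_adj.2 ?_))
    intro T S h
    obtain ⟨hT, hS, h | h⟩ := ColoredTree.colorGraph_adj.1 h
    · exact hcard (ColoredTree.four_le_card_of_rotates h hT hS)
    · exact hcard (ColoredTree.four_le_card_of_rotates h hS hT)
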